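/- Let $k$ be a field, let $B$ be a $k$-bialgebra with comultiplication $\Delta$ and counit $\varepsilon$, and let $d\colon B\to B$ be a $k$-linear derivation ($d(ab)=d(a)b+a\,d(b)$) such that for all $b\in B$ $$\Delta(d(b)) = d(b_{(1)})\otimes b_{(2)} + b_{(1)}\otimes d(b_{(2)}),\qquad \varepsilon(d(b))=0 .$$ Let $H=B[x;d]$ be the Ore extension, i.e. the $k$-algebra generated by the algebra $B$ and an element $x$ subject to the relations $xb=bx+d(b)$ for $b\in B$. Then: 1. The algebra $H$ carries a bialgebra structure with $\Delta(x)=x\otimes 1+1\otimes x$ and $\varepsilon(x)=0$ for which the natural algebra map $f\colon B\to H$ is an injective bialgebra map. 2. Let $T=H\otimes_B-$ be the bimonad on the monoidal category $B\text{-}\mathrm{Mod}$ of left $B$-modules (with tensor product $\otimes_k$) induced by extension and restriction of scalars along $f$, with multiplication $\mu(h\otimes(h'\otimes m))=hh'\otimes m$, unit $m\mapsto 1\otimes m$, and comonoidal structure $T_2(h\otimes(m\otimes n))=(h_{(1)}\otimes m)\otimes(h_{(2)}\otimes n)$, $T_0(h\otimes c)=\varepsilon(h)c$. Then $T$ is left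 Hopf: for all left $B$-modules $M,N$ the left fusion operator $$T(M\otimes T(N))\xrightarrow{\;T_2\;}T(M)\otimes TT(N)\xrightarrow{\;\mathrm{id}\otimes\mu\;}T(M)\otimes T(N)$$ is invertible. 3. The left closed structure of $B\text{-}\mathrm{Mod}$ lifts to $H\text{-}\mathrm{Mod}$. That is, let $[M,N]=\mathrm{Hom}_B(B\otimes_k M,N)$ with $(b\varphi)(b'\otimes m)=\varphi(b'b\otimes m)$, so that $[M,-]$ is right adjoint to $-\otimes M$ with unit $n\mapsto(b\otimes m\mapsto bn\otimes m)$ and counit $\varphi\otimes m\mapsto\varphi(1\otimes m)$, and let $U\colon H\text{-}\mathrm{Mod}\to B\text{-}\mathrm{Mod}$ be restriction of scalars along $f$. Then for every left $H$-module $M$ the functor $-\otimes M$ on $H\text{-}\mathrm{Mod}$ has a right adjoint $R_M$ together with a natural isomorphism $U R_M\cong [U(M),U(-)]$ under which $U$ carries the unit and counit of $-\otimes M\dashv R_M$ to the unit and counit of $-\otimes U(M)\dashv[U(M),-]$ (using the canonical identification $U(N\otimes M)=U(N)\otimes U(M)$). -/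

import Mathlib

open CategoryTheory MonoidalCategory TensorProduct

universe v w v' w' u

section TensorRep

variable {k B : Type u} [CommRing k] [Ring B] [Bialgebra k B]
  {V W X : Type u} [AddCommGroup V] [Module k V] [AddCommGroup W] [Module k W]
  [AddCommGroup X] [Module k X]

/-- The action of `B ⊗ B` on `V ⊗ W`, `(a ⊗ b)(v ⊗ w) = a v ⊗ b w`. -/
def prodRep {k B : Type u} [CommRing k] [Ring B] [Algebra k B]
    {V W : Type u} [AddCommGroup V] [Module k V] [AddCommGroup W] [Module k W]
    (ρ : B →ₐ[k] Module.End k V) (σ : B →ₐ[k] Module.End k W) :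
    B ⊗[k] B →ₐ[k] Module.End k (V ⊗[k] W) :=
  Module.endTensorEndAlgHom.comp (Algebra.TensorProduct.map ρ σ)

@[simp]
theorem prodRep_tmul (ρ : B →ₐ[k] Module.End k V) (σ : B →ₐ[k] Module.End k W)
    (a b : B) (v : V) (w : W) : prodRep ρ σ (a ⊗ₜ b) (v ⊗ₜ w) = ρ a v ⊗ₜ σ b w := rfl

/-- The action of a bialgebra on a tensor product, `b (v ⊗ w) = b₍₁₎ v ⊗ b₍₂₎ w`. -/
def tensorRep (ρ : B →ₐ[k] Module.End k V) (σ : B →ₐ[k] Module.End k W) :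
    B →ₐ[k] Module.End k (V ⊗[k] W) :=
  (prodRep ρ σ).comp (Bialgebra.comulAlgHom k B)

theorem tensorRep_apply (ρ : B →ₐ[k] Module.End k V) (σ : B →ₐ[k] Module.End k W) (b : B)
    (t : V ⊗[k] W) : tensorRep ρ σ b t = prodRep ρ σ (Coalgebra.comul b) t := rfl

/-- The action of a bialgebra on the base ring through the counit. -/
def unitRep (k B : Type u) [CommRing k] [Ring B] [Bialgebra k B] : B →ₐ[k] Module.End k k :=
  (Algebra.lsmul k k k).comp (Bialgebra.counitAlgHom k B)

theorem unitRep_apply (b : B) (c : k) :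
    unitRep k B b c = Coalgebra.counit (R := k) b * c := rfl

theorem prodRep_map {V' W' : Type u} [AddCommGroup V'] [Module k V'] [AddCommGroup W'] [Module k W']
    {ρ : B →ₐ[k] Module.End k V} {σ : B →ₐ[k] Module.End k W}
    {ρ' : B →ₐ[k] Module.End k V'} {σ' : B →ₐ[k] Module.End k W'}
    (f : V →ₗ[k] V') (g : W →ₗ[k] W') (hf : ∀ b v, f (ρ b v) = ρ' b (f v))
    (hg : ∀ b w, g (σ b w) = σ' b (g w)) (u : B ⊗[k] B) (t : V ⊗[k] W) :
    TensorProduct.map f g (prodRep ρ σ u t) = prodRep ρ' σ' u (TensorProduct.map f g t) := by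
  induction u with
  | zero => simp
  | add x y hx hy => simp only [map_add, LinearMap.add_apply, hx, hy]
  | tmul a b =>
    induction t with
    | zero => simp
    | add x y hx hy => simp only [map_add, hx, hy]
    | tmul v w => simp [hf, hg]

theorem assoc_tensorRep (ρ : B →ₐ[k] Module.End k V) (σ : B →ₐ[k] Module.End k W)
    (τ : B →ₐ[k] Module.End k X) (b : B) (t : (V ⊗[k] W) ⊗[k] X) :
    TensorProduct.assoc k V W X (tensorRep (tensorRep ρ σ) τ b t) =
      tensorRep ρ (tensorRep σ τ) b (TensorProduct.assoc k V W X t) := by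
  let A : B ⊗[k] (B ⊗[k] B) →ₐ[k] Module.End k (V ⊗[k] (W ⊗[k] X)) :=
    Module.endTensorEndAlgHom.comp (Algebra.TensorProduct.map ρ (prodRep σ τ))
  have h₁ : ∀ (u : B ⊗[k] B) (s : V ⊗[k] (W ⊗[k] X)), prodRep ρ (tensorRep σ τ) u s =
      A (Coalgebra.comul.lTensor B u) s := by
    intro u s
    induction u with
    | zero => simp
    | add x y hx hy => simp only [map_add, LinearMap.add_apply, hx, hy]
    | tmul a b => rfl
  have h₂ : ∀ (u : B ⊗[k] B) (c : B) (s : V ⊗[k] W) (x : X),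
      TensorProduct.assoc k V W X (prodRep ρ σ u s ⊗ₜ τ c x) =
      A (TensorProduct.assoc k B B B (u ⊗ₜ c)) (TensorProduct.assoc k V W X (s ⊗ₜ x)) := by
    intro u c s x
    induction u with
    | zero => simp
    | add x y hx hy => simp only [map_add, LinearMap.add_apply, hx, hy, add_tmul]
    | tmul a b =>
      induction s with
      | zero => simp
      | add x y hx hy => simp only [map_add, hx, hy, add_tmul]
      | tmul m n => rfl
  have h₃ : ∀ (u : B ⊗[k] B) (s : (V ⊗[k] W) ⊗[k] X),
      TensorProduct.assoc k V W X (prodRep (tensorRep ρ σ) τ u s) =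
      A (TensorProduct.assoc k B B B (Coalgebra.comul.rTensor B u))
        (TensorProduct.assoc k V W X s) := by
    intro u s
    induction u with
    | zero => simp
    | add x y hx hy => simp only [map_add, LinearMap.add_apply, hx, hy]
    | tmul a b =>
      induction s with
      | zero => simp
      | add x y hx hy => simp only [map_add, hx, hy]
      | tmul s p => exact h₂ (Coalgebra.comul a) b s p
  rw [tensorRep_apply, tensorRep_apply, h₃, h₁, Coalgebra.coassoc_apply]

theorem lid_tensorRep (ρ : B →ₐ[k] Module.End k V) (b : B) (t : k ⊗[k] V) :
    TensorProduct.lid k V (tensorRep (unitRep k B) ρ b t) = ρ b (TensorProduct.lid k V t) := by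
  have h : ∀ (u : B ⊗[k] B) (t : k ⊗[k] V),
      TensorProduct.lid k V (prodRep (unitRep k B) ρ u t) =
      ρ (TensorProduct.lid k B (Coalgebra.counit.rTensor B u)) (TensorProduct.lid k V t) := by
    intro u t
    induction u with
    | zero => simp
    | add x y hx hy => simp only [map_add, LinearMap.add_apply, hx, hy]
    | tmul a b =>
      induction t with
      | zero => simp
      | add x y hx hy => simp only [map_add, hx, hy]
      | tmul c v => simpa [unitRep_apply, mul_smul] using smul_comm _ _ _
  rw [tensorRep_apply, h, Coalgebra.rTensor_counit_comul]
  simp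

theorem rid_tensorRep (ρ : B →ₐ[k] Module.End k V) (b : B) (t : V ⊗[k] k) :
    TensorProduct.rid k V (tensorRep ρ (unitRep k B) b t) = ρ b (TensorProduct.rid k V t) := by
  have h : ∀ (u : B ⊗[k] B) (t : V ⊗[k] k),
      TensorProduct.rid k V (prodRep ρ (unitRep k B) u t) =
      ρ (TensorProduct.rid k B (Coalgebra.counit.lTensor B u)) (TensorProduct.rid k V t) := by
    intro u t
    induction u with
    | zero => simp
    | add x y hx hy => simp only [map_add, LinearMap.add_apply, hx, hy]
    | tmul a b =>
      induction t with
      | zero => simp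
      | add x y hx hy => simp only [map_add, hx, hy]
      | tmul v c => simpa [unitRep_apply, mul_smul] using smul_comm _ _ _
  rw [tensorRep_apply, h, Coalgebra.lTensor_counit_comul]
  simp

end TensorRep

/-- A left module over the `k`-algebra `B`. The `k`-module structure is the one obtained by restricting
the `B`-action along `k → B` (this is what `isScalarTower` says); it is stored only for convenience. -/
structure LMod (k B : Type u) [CommRing k] [Ring B] [Algebra k B] where
  carrier : Type u
  [addCommGroup : AddCommGroup carrier]
  [moduleBase : Module k carrier]
  [module : Module B carrier]
  [isScalarTower : IsScalarTower k B carrier]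

namespace LMod

section Category

variable {k B : Type u} [CommRing k] [Ring B] [Algebra k B]

instance : CoeSort (LMod k B) (Type u) := ⟨carrier⟩

attribute [instance] addCommGroup moduleBase module isScalarTower

/-- Morphisms of left `B`-modules are the `B`-linear maps. -/
@[ext]
structure Hom (M N : LMod k B) where
  hom : M →ₗ[B] N

instance : Category (LMod k B) where
  Hom M N := Hom M N
  id M := ⟨LinearMap.id⟩
  comp f g := ⟨g.hom.comp f.hom⟩

@[ext]
theorem hom_ext {M N : LMod k B} {f g : M ⟶ N} (h : ∀ x : M, f.hom x = g.hom x) : f = g :=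
  Hom.ext (LinearMap.ext h)

@[simp] theorem id_hom (M : LMod k B) : Hom.hom (𝟙 M) = LinearMap.id := rfl

@[simp] theorem comp_hom {M N P : LMod k B} (f : M ⟶ N) (g : N ⟶ P) :
    (f ≫ g).hom = g.hom.comp f.hom := rfl

/-- The forgetful functor to `k`-modules. -/
def forgetBase : LMod k B ⥤ ModuleCat.{u} k where
  obj M := ModuleCat.of k M
  map f := ModuleCat.ofHom (f.hom.restrictScalars k)

instance : (forgetBase (k := k) (B := B)).Faithful where
  map_injective h := by
    ext x
    exact congrArg (fun g => g.hom x) h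

/-- A `k`-linear map that commutes with the action of `B` is a morphism of `B`-modules. -/
def mkHom {M N : LMod k B} (φ : M →ₗ[k] N) (h : ∀ (b : B) (m : M), φ (b • m) = b • φ m) :
    M ⟶ N where
  hom := { toFun := φ, map_add' := map_add φ, map_smul' := h }

/-- The underlying `k`-linear map of a morphism of `B`-modules. -/
def base {M N : LMod k B} (f : M ⟶ N) : M →ₗ[k] N := f.hom.restrictScalars k

@[simp] theorem base_apply {M N : LMod k B} (f : M ⟶ N) (m : M) : base f m = f.hom m := rfl

/-- The `B`-module given by a representation `B → End_k(V)`. -/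
def ofAlgHom (V : Type u) [AddCommGroup V] [Module k V] (ρ : B →ₐ[k] Module.End k V) :
    LMod k B :=
  letI : Module B V := Module.compHom V ρ.toRingHom
  haveI : IsScalarTower k B V := ⟨fun r b v => by
    change ρ (r • b) v = r • ρ b v
    rw [map_smul]; rfl⟩
  { carrier := V }

/-- The representation `B → End_k(M)` of a `B`-module. -/
def rep (M : LMod k B) : B →ₐ[k] Module.End k M := Algebra.lsmul k k M

theorem rep_apply (M : LMod k B) (b : B) (m : M) : M.rep b m = b • m := rfl

/-- A `k`-linear equivalence that commutes with the action of `B` is an isomorphism of `B`-modules. -/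
def mkIso {M N : LMod k B} (e : M ≃ₗ[k] N) (h : ∀ (b : B) (m : M), e (b • m) = b • e m) :
    M ≅ N where
  hom := mkHom e.toLinearMap h
  inv := mkHom e.symm.toLinearMap fun b n => by
    apply e.injective
    change e (e.symm (b • n)) = e (b • e.symm n)
    rw [h, e.apply_symm_apply, e.apply_symm_apply]
  hom_inv_id := by ext x; exact e.symm_apply_apply x
  inv_hom_id := by ext x; exact e.apply_symm_apply x

end Category

section Monoidal

variable {k B : Type u} [CommRing k] [Ring B] [Bialgebra k B]

/-- The tensor product over `k` of two modules over a bialgebra. -/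
def tensor (M N : LMod k B) : LMod k B :=
  ofAlgHom (M ⊗[k] N) (tensorRep M.rep N.rep)

/-- The unit object: `k` with `B` acting through the counit. -/
def unit (k B : Type u) [CommRing k] [Ring B] [Bialgebra k B] : LMod k B :=
  ofAlgHom k (unitRep k B)

def tensorMap {M M' N N' : LMod k B} (f : M ⟶ M') (g : N ⟶ N') : tensor M N ⟶ tensor M' N' :=
  mkHom (TensorProduct.map (base f) (base g)) fun b t =>
    prodRep_map (base f) (base g) (map_smul f.hom) (map_smul g.hom) (Coalgebra.comul b) t

instance : MonoidalCategoryStruct (LMod k B) where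
  tensorObj := tensor
  whiskerLeft M _ _ g := tensorMap (𝟙 M) g
  whiskerRight f N := tensorMap f (𝟙 N)
  tensorHom := tensorMap
  tensorUnit := unit k B
  associator M N P := mkIso (TensorProduct.assoc k M N P) (assoc_tensorRep M.rep N.rep P.rep)
  leftUnitor M := mkIso (TensorProduct.lid k M) (lid_tensorRep M.rep)
  rightUnitor M := mkIso (TensorProduct.rid k M) (rid_tensorRep M.rep)

/-- The monoidal category of left modules over the bialgebra `B`; the coherence isomorphisms are those
of `k`-modules. -/
instance : MonoidalCategory (LMod k B) :=
  Monoidal.induced forgetBase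
    { μIso := fun M N => Iso.refl _
      εIso := Iso.refl _
      whiskerLeft_eq := by intros; rfl
      whiskerRight_eq := by intros; rfl
      tensorHom_eq := by intros; rfl
      associator_eq := fun M N P => by
        apply ModuleCat.hom_ext
        apply TensorProduct.ext_threefold
        intros; rfl
      leftUnitor_eq := fun M => by
        apply ModuleCat.hom_ext
        apply TensorProduct.ext'
        intros; rfl
      rightUnitor_eq := fun M => by
        apply ModuleCat.hom_ext
        apply TensorProduct.ext'
        intros; rfl }

end Monoidal
end LMod

namespace LMod
section Restriction

variable {k B H : Type u} [CommRing k] [Ring B] [Bialgebra k B] [Ring H] [Bialgebra k H]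

/-- Restriction of scalars along a bialgebra map, on objects. -/
def restrictObj (f : B →ₐc[k] H) (M : LMod k H) : LMod k B :=
  ofAlgHom M (M.rep.comp (f : B →ₐ[k] H))

theorem restrictObj_smul (f : B →ₐc[k] H) (M : LMod k H) (b : B) (m : M) :
    b • (show restrictObj f M from m) = f b • m := rfl

def restrictMap (f : B →ₐc[k] H) {M N : LMod k H} (g : M ⟶ N) : restrictObj f M ⟶ restrictObj f N :=
  let φ : M →ₗ[k] N := base g
  have hφ : ∀ (h : H) (m : M), φ (h • m) = h • φ m := map_smul g.hom
  mkHom (M := restrictObj f M) (N := restrictObj f N) φ fun b m => hφ (f b) m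

/-- Restriction of scalars `U : H-Mod ⥤ B-Mod` along a bialgebra map. -/
def restrict (f : B →ₐc[k] H) : LMod k H ⥤ LMod k B where
  obj := restrictObj f
  map g := restrictMap f g

theorem tensorRep_comp {V W : Type u} [AddCommGroup V] [Module k V] [AddCommGroup W] [Module k W]
    (f : B →ₐc[k] H) (ρ : H →ₐ[k] Module.End k V) (σ : H →ₐ[k] Module.End k W) (b : B)
    (t : V ⊗[k] W) :
    tensorRep (ρ.comp (f : B →ₐ[k] H)) (σ.comp (f : B →ₐ[k] H)) b t = tensorRep ρ σ (f b) t := by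
  have h : ∀ u : B ⊗[k] B, prodRep (ρ.comp (f : B →ₐ[k] H)) (σ.comp (f : B →ₐ[k] H)) u =
      prodRep ρ σ (TensorProduct.map (f : B →ₗ[k] H) (f : B →ₗ[k] H) u) := by
    intro u
    induction u with
    | zero => simp
    | add x y hx hy => simp only [map_add, hx, hy]
    | tmul a b => rfl
  rw [tensorRep_apply, tensorRep_apply, h]
  congr 2
  exact CoalgHomClass.map_comp_comul_apply f b

theorem unitRep_comp (f : B →ₐc[k] H) (b : B) (c : k) : unitRep k B b c = unitRep k H (f b) c := by
  rw [unitRep_apply, unitRep_apply, CoalgHomClass.counit_comp_apply]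

/-- Restriction of scalars is strong monoidal, the structure maps being identities on elements. -/
instance restrictMonoidal (f : B →ₐc[k] H) : (restrict f).Monoidal :=
  Functor.CoreMonoidal.toMonoidal
    { εIso := mkIso (M := unit k B) (N := restrictObj f (unit k H)) (LinearEquiv.refl k k)
        (unitRep_comp f)
      μIso := fun M N =>
        mkIso (M := tensor (restrictObj f M) (restrictObj f N)) (N := restrictObj f (tensor M N))
          (LinearEquiv.refl k (M ⊗[k] N)) (tensorRep_comp f M.rep N.rep)
      μIso_hom_natural_left := fun _ _ => rfl
      μIso_hom_natural_right := fun _ _ => rfl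
      associativity := fun M N P => by
        apply forgetBase.map_injective
        apply ModuleCat.hom_ext
        apply TensorProduct.ext_threefold
        intros; rfl
      left_unitality := fun M => by
        apply forgetBase.map_injective
        apply ModuleCat.hom_ext
        apply TensorProduct.ext'
        intros; rfl
      right_unitality := fun M => by
        apply forgetBase.map_injective
        apply ModuleCat.hom_ext
        apply TensorProduct.ext'
        intros; rfl }

/-- The submodule of `H ⊗ M` spanned by the `h f(b) ⊗ m - h ⊗ b m`. -/
def balanced (f : B →ₐc[k] H) (M : LMod k B) : Submodule H (H ⊗[k] M) :=
  Submodule.span H {t | ∃ (h : H) (b : B) (m : M), t = (h * f b) ⊗ₜ[k] m - h ⊗ₜ[k] (b • m)}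

/-- The `H`-module `H ⊗_B M`, with `H` acting on the left factor. -/
def induceObj (f : B →ₐc[k] H) (M : LMod k B) : LMod k H where
  carrier := (H ⊗[k] M) ⧸ balanced f M

/-- The quotient map `H ⊗ M → H ⊗_B M`. -/
def induceMk (f : B →ₐc[k] H) (M : LMod k B) : H ⊗[k] M →ₗ[H] induceObj f M :=
  (balanced f M).mkQ

theorem induceMk_mul_tmul (f : B →ₐc[k] H) (M : LMod k B) (h : H) (b : B) (m : M) :
    induceMk f M ((h * f b) ⊗ₜ m) = induceMk f M (h ⊗ₜ (b • m)) :=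
  (Submodule.Quotient.eq _).2 (Submodule.subset_span ⟨h, b, m, rfl⟩)

/-- A morphism `M ⟶ U N` as a `k`-linear map `M → N`. -/
def toBase (f : B →ₐc[k] H) {M : LMod k B} {N : LMod k H} (g : M ⟶ restrictObj f N) :
    M →ₗ[k] N := base g

theorem toBase_smul (f : B →ₐc[k] H) {M : LMod k B} {N : LMod k H} (g : M ⟶ restrictObj f N)
    (b : B) (m : M) : toBase f g (b • m) = f b • toBase f g m := map_smul g.hom b m

/-- The morphism `H ⊗_B M ⟶ N`, `h ⊗ m ↦ h g(m)`, induced by `g : M ⟶ U N`. -/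
def induceDesc (f : B →ₐc[k] H) {M : LMod k B} {N : LMod k H} (g : M ⟶ restrictObj f N) :
    induceObj f M ⟶ N where
  hom := (balanced f M).liftQ
    (AlgebraTensorModule.lift (LinearMap.toSpanSingleton H (M →ₗ[k] N) (toBase f g))) <| by
      rw [balanced, Submodule.span_le]
      rintro _ ⟨h, b, m, rfl⟩
      simp [toBase_smul, mul_smul]

theorem induceDesc_mk (f : B →ₐc[k] H) {M : LMod k B} {N : LMod k H} (g : M ⟶ restrictObj f N)
    (h : H) (m : M) : (induceDesc f g).hom (induceMk f M (h ⊗ₜ m)) = h • toBase f g m :=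
  rfl

/-- The morphism `M ⟶ U (H ⊗_B M)`, `m ↦ 1 ⊗ m`. -/
def induceUnit (f : B →ₐc[k] H) (M : LMod k B) : M ⟶ restrictObj f (induceObj f M) :=
  let φ : M →ₗ[k] induceObj f M :=
    (induceMk f M).restrictScalars k ∘ₗ TensorProduct.mk k H M 1
  have hφ : ∀ (b : B) (m : M), φ (b • m) = f b • φ m := fun b m => by
    change induceMk f M (1 ⊗ₜ (b • m)) = f b • induceMk f M (1 ⊗ₜ m)
    rw [← induceMk_mul_tmul, ← map_smul, smul_tmul', one_mul, smul_eq_mul, mul_one]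
  mkHom (N := restrictObj f (induceObj f M)) φ hφ

theorem induce_hom_ext (f : B →ₐc[k] H) {M : LMod k B} {N : LMod k H} {φ ψ : induceObj f M ⟶ N}
    (h : ∀ m : M, φ.hom (induceMk f M (1 ⊗ₜ m)) = ψ.hom (induceMk f M (1 ⊗ₜ m))) : φ = ψ := by
  have key : φ.hom ∘ₗ induceMk f M = ψ.hom ∘ₗ induceMk f M := by
    apply AlgebraTensorModule.ext
    intro a m
    have : a ⊗ₜ[k] m = a • ((1 : H) ⊗ₜ[k] m) := by rw [smul_tmul', smul_eq_mul, mul_one]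
    rw [this, map_smul, map_smul]
    exact congrArg (a • ·) (h m)
  ext y
  obtain ⟨t, rfl⟩ := Submodule.mkQ_surjective _ y
  exact LinearMap.congr_fun key t

def induceHomEquiv (f : B →ₐc[k] H) (M : LMod k B) (N : LMod k H) :
    (induceObj f M ⟶ N) ≃ (M ⟶ (restrict f).obj N) where
  toFun φ := induceUnit f M ≫ (restrict f).map φ
  invFun g := induceDesc f g
  left_inv φ := induce_hom_ext f fun m =>
    one_smul H (φ.hom (induceMk f M (1 ⊗ₜ m)))
  right_inv g := hom_ext fun m => one_smul H (toBase f g m)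

/-- Extension of scalars `H ⊗_B - : B-Mod ⥤ H-Mod`. -/
def induce (f : B →ₐc[k] H) : LMod k B ⥤ LMod k H :=
  Adjunction.leftAdjointOfEquiv (G := restrict f) (F_obj := induceObj f) (induceHomEquiv f)
    fun _ _ _ _ _ => rfl

/-- Extension of scalars is left adjoint to restriction of scalars. -/
def induceAdj (f : B →ₐc[k] H) : induce f ⊣ restrict f :=
  Adjunction.adjunctionOfEquivLeft (induceHomEquiv f) fun _ _ _ _ _ => rfl

end Restriction
end LMod

/-- A bimonad on a monoidal category: a monad `(T, μ, η)` whose functor carries a comonoidal structure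
`T₂ = oplax.δ`, `T₀ = oplax.η` such that `μ` and `η` are comonoidal natural transformations. -/
structure Bimonad (C : Type w) [Category.{v} C] [MonoidalCategory C] extends Monad C where
  oplax : toFunctor.OplaxMonoidal
  mu_comonoidal : ∀ X Y : C, μ.app (X ⊗ Y) ≫ oplax.δ X Y =
    toFunctor.map (oplax.δ X Y) ≫ oplax.δ (toFunctor.obj X) (toFunctor.obj Y) ≫
      (μ.app X ⊗ₘ μ.app Y)
  eta_comonoidal : ∀ X Y : C, η.app (X ⊗ Y) ≫ oplax.δ X Y = (η.app X ⊗ₘ η.app Y)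
  mu_counital : μ.app (𝟙_ C) ≫ oplax.η = toFunctor.map oplax.η ≫ oplax.η
  eta_counital : η.app (𝟙_ C) ≫ oplax.η = 𝟙 (𝟙_ C)

namespace Bimonad

variable {C : Type w} [Category.{v} C] [MonoidalCategory C]
  {D : Type w'} [Category.{v'} D] [MonoidalCategory D]

/-- The left fusion operator
`T(X ⊗ T Y) ⟶ T X ⊗ T (T Y) ⟶ T X ⊗ T Y`. -/
def leftFusion (T : Bimonad C) (X Y : C) : T.obj (X ⊗ T.obj Y) ⟶ T.obj X ⊗ T.obj Y :=
  T.oplax.δ X (T.obj Y) ≫ (T.obj X ◁ T.μ.app Y)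

/-- A bimonad is left Hopf if its left fusion operator is invertible. -/
def IsLeftHopf (T : Bimonad C) : Prop :=
  ∀ X Y : C, IsIso (T.leftFusion X Y)

open Functor.OplaxMonoidal Functor.LaxMonoidal

section

variable {F : C ⥤ D} {U : D ⥤ C} (adj : F ⊣ U) [U.Monoidal]

/-- The comonoidal structure on `T = U F` for an adjunction `F ⊣ U` with `U` strong monoidal. -/
@[reducible]
def oplaxOfAdjunction : (F ⋙ U).OplaxMonoidal :=
  letI := adj.leftAdjointOplaxMonoidal
  inferInstance

theorem oplaxOfAdjunction_δ (X Y : C) :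
    (oplaxOfAdjunction adj).δ X Y =
      U.map (F.map (adj.unit.app X ⊗ₘ adj.unit.app Y) ≫
        F.map (μ U (F.obj X) (F.obj Y)) ≫ adj.counit.app (F.obj X ⊗ F.obj Y)) ≫
      δ U (F.obj X) (F.obj Y) := by
  let := adj.leftAdjointOplaxMonoidal
  change U.map (δ F X Y) ≫ δ U _ _ = _
  rw [Adjunction.leftAdjointOplaxMonoidal_δ, Adjunction.homEquiv_counit, F.map_comp,
    Category.assoc]

theorem oplaxOfAdjunction_η :
    (oplaxOfAdjunction adj).η = U.map (F.map (ε U) ≫ adj.counit.app (𝟙_ D)) ≫ η U := by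
  let := adj.leftAdjointOplaxMonoidal
  change U.map (η F) ≫ η U = _
  rw [Adjunction.leftAdjointOplaxMonoidal_η, Adjunction.homEquiv_counit]

theorem ofAdjunction_mu (X Y : C) :
    U.map (adj.counit.app (F.obj (X ⊗ Y))) ≫ (oplaxOfAdjunction adj).δ X Y =
      U.map (F.map ((oplaxOfAdjunction adj).δ X Y)) ≫
        (oplaxOfAdjunction adj).δ (U.obj (F.obj X)) (U.obj (F.obj Y)) ≫
          (U.map (adj.counit.app (F.obj X)) ⊗ₘ U.map (adj.counit.app (F.obj Y))) := by
  let := adj.leftAdjointOplaxMonoidal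
  change U.map (adj.counit.app (F.obj (X ⊗ Y))) ≫ U.map (δ F X Y) ≫ δ U _ _ =
    U.map (F.map (U.map (δ F X Y) ≫ δ U _ _)) ≫ (U.map (δ F _ _) ≫ δ U _ _) ≫
      (U.map (adj.counit.app (F.obj X)) ⊗ₘ U.map (adj.counit.app (F.obj Y)))
  have h : δ U (F.obj (U.obj (F.obj X))) (F.obj (U.obj (F.obj Y))) ≫
      (U.map (adj.counit.app (F.obj X)) ⊗ₘ U.map (adj.counit.app (F.obj Y))) =
      U.map (adj.counit.app (F.obj X) ⊗ₘ adj.counit.app (F.obj Y)) ≫ δ U (F.obj X) (F.obj Y) :=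
    δ_natural U (adj.counit.app (F.obj X)) (adj.counit.app (F.obj Y))
  rw [Category.assoc, h, ← U.map_comp_assoc (δ F _ _),
    ← adj.map_μ_comp_counit_app_tensor, ← U.map_comp_assoc, ← U.map_comp_assoc]
  congr 2
  rw [← F.map_comp_assoc, Category.assoc, Functor.Monoidal.δ_μ, Category.comp_id]
  exact (adj.counit.naturality (δ F X Y)).symm

theorem ofAdjunction_eta (X Y : C) :
    adj.unit.app (X ⊗ Y) ≫ (oplaxOfAdjunction adj).δ X Y =
      (adj.unit.app X ⊗ₘ adj.unit.app Y) := by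
  let := adj.leftAdjointOplaxMonoidal
  change adj.unit.app (X ⊗ Y) ≫ U.map (δ F X Y) ≫ δ U _ _ = _
  rw [adj.unit_app_tensor_comp_map_δ_assoc, Functor.Monoidal.μ_δ, Category.comp_id]

theorem ofAdjunction_mu_counital :
    U.map (adj.counit.app (F.obj (𝟙_ C))) ≫ (oplaxOfAdjunction adj).η =
      U.map (F.map (oplaxOfAdjunction adj).η) ≫ (oplaxOfAdjunction adj).η := by
  let := adj.leftAdjointOplaxMonoidal
  change U.map (adj.counit.app (F.obj (𝟙_ C))) ≫ U.map (η F) ≫ η U =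
    U.map (F.map (U.map (η F) ≫ η U)) ≫ U.map (η F) ≫ η U
  rw [← adj.map_ε_comp_counit_app_unit, ← U.map_comp_assoc, ← U.map_comp_assoc]
  congr 2
  rw [← F.map_comp_assoc, Category.assoc, Functor.Monoidal.η_ε, Category.comp_id]
  exact (adj.counit.naturality _).symm

theorem ofAdjunction_eta_counital :
    adj.unit.app (𝟙_ C) ≫ (oplaxOfAdjunction adj).η = 𝟙 (𝟙_ C) := by
  let := adj.leftAdjointOplaxMonoidal
  change adj.unit.app (𝟙_ C) ≫ U.map (η F) ≫ η U = _
  rw [adj.unit_app_unit_comp_map_η_assoc, Functor.Monoidal.ε_η]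

/-- The bimonad `T = U F` induced by an adjunction `F ⊣ U` with `U` strong monoidal. -/
def ofAdjunction : Bimonad C where
  toMonad := adj.toMonad
  oplax := oplaxOfAdjunction adj
  mu_comonoidal := ofAdjunction_mu adj
  eta_comonoidal := ofAdjunction_eta adj
  mu_counital := ofAdjunction_mu_counital adj
  eta_counital := ofAdjunction_eta_counital adj

end

end Bimonad

namespace LMod
section Closed
variable {k B : Type u} [CommRing k] [Ring B] [Bialgebra k B]

/-- `B` as a left module over itself. -/
def regular (k B : Type u) [CommRing k] [Ring B] [Algebra k B] : LMod k B where
  carrier := B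

/-- The morphism `B ⟶ M`, `b ↦ b m`. -/
def orbit (M : LMod k B) (m : M) : regular k B ⟶ M where
  hom := LinearMap.toSpanSingleton B M m

theorem orbit_apply (M : LMod k B) (m : M) (b : B) : (orbit M m).hom b = b • m := rfl

/-- The action of `b` on `Hom_B(B ⊗ M, N)`: `(b φ)(b' ⊗ m) = φ(b' b ⊗ m)`. -/
def homAct (M N : LMod k B) (b : B) :
    Module.End k (tensor (regular k B) M →ₗ[B] N) where
  toFun φ := φ.comp (tensorMap (orbit (regular k B) b) (𝟙 M)).hom
  map_add' _ _ := rfl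
  map_smul' _ _ := rfl

theorem hom_tensor_ext {M N P : LMod k B} {φ ψ : tensor P M →ₗ[B] N}
    (h : ∀ (p : P) (m : M), φ (p ⊗ₜ[k] m) = ψ (p ⊗ₜ[k] m)) : φ = ψ := by
  have : (φ.restrictScalars k : P ⊗[k] M →ₗ[k] N) = (ψ.restrictScalars k : P ⊗[k] M →ₗ[k] N) :=
    TensorProduct.ext' h
  exact LinearMap.ext fun t => LinearMap.congr_fun this t

/-- The value `φ(b ⊗ m)`. -/
def homVal {M N : LMod k B} (φ : tensor (regular k B) M →ₗ[B] N) : B →ₗ[k] M →ₗ[k] N :=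
  TensorProduct.curry (φ.restrictScalars k : B ⊗[k] M →ₗ[k] N)

theorem homVal_ext {M N : LMod k B} {φ ψ : tensor (regular k B) M →ₗ[B] N}
    (h : ∀ (b : B) (m : M), homVal φ b m = homVal ψ b m) : φ = ψ :=
  hom_tensor_ext h

theorem homVal_homAct {M N : LMod k B} (b : B) (φ : tensor (regular k B) M →ₗ[B] N) (b' : B)
    (m : M) : homVal (homAct M N b φ) b' m = homVal φ (b' * b) m := rfl

def homRep (M N : LMod k B) : B →ₐ[k] Module.End k (tensor (regular k B) M →ₗ[B] N) :=
  AlgHom.ofLinearMap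
    { toFun := homAct M N
      map_add' := fun a b => LinearMap.ext fun φ => homVal_ext fun b' m => by
        change homVal φ (b' * (a + b)) m = homVal φ (b' * a) m + homVal φ (b' * b) m
        rw [mul_add, map_add, LinearMap.add_apply]
      map_smul' := fun r b => LinearMap.ext fun φ => homVal_ext fun b' m => by
        change homVal φ (b' * (r • b)) m = r • homVal φ (b' * b) m
        rw [mul_smul_comm, map_smul, LinearMap.smul_apply] }
    (LinearMap.ext fun φ => homVal_ext fun b' m => by
      change homVal φ (b' * 1) m = homVal φ b' m
      rw [mul_one])
    fun a b => LinearMap.ext fun φ => homVal_ext fun b' m => by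
      change homVal φ (b' * (a * b)) m = homVal φ (b' * a * b) m
      rw [mul_assoc]

/-- The left inner hom `[M, N] = Hom_B(B ⊗ M, N)` of `B`-modules. -/
def leftHomObj (M N : LMod k B) : LMod k B :=
  ofAlgHom (tensor (regular k B) M →ₗ[B] N) (homRep M N)

/-- The functor `[M, -]`. -/
def leftHom (M : LMod k B) : LMod k B ⥤ LMod k B where
  obj N := leftHomObj M N
  map {N N'} g :=
    let φ : (tensor (regular k B) M →ₗ[B] N) →ₗ[k] (tensor (regular k B) M →ₗ[B] N') :=
      { toFun := fun φ => g.hom.comp φ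
        map_add' := fun φ ψ => LinearMap.comp_add _ _ _
        map_smul' := fun r φ => LinearMap.ext fun t => map_smul (base g) r (φ t) }
    mkHom (M := leftHomObj M N) (N := leftHomObj M N') φ fun _ _ => rfl

/-- The coevaluation `N ⟶ [M, N ⊗ M]`, `n ↦ (b ⊗ m ↦ b n ⊗ m)`. -/
def coev (M N : LMod k B) : N ⟶ leftHomObj M (tensor N M) :=
  let φ : N →ₗ[k] (tensor (regular k B) M →ₗ[B] tensor N M) :=
    { toFun := fun n => (tensorMap (orbit N n) (𝟙 M)).hom
      map_add' := fun n n' => homVal_ext fun b m => by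
        change (b • (n + n')) ⊗ₜ[k] m = (b • n) ⊗ₜ[k] m + (b • n') ⊗ₜ[k] m
        rw [smul_add, add_tmul]
      map_smul' := fun r n => homVal_ext fun b m => by
        change (b • (r • n)) ⊗ₜ[k] m = r • ((b • n) ⊗ₜ[k] m)
        rw [smul_comm, smul_tmul'] }
  mkHom (N := leftHomObj M (tensor N M)) φ fun b n => homVal_ext fun b' m => by
    change (b' • (b • n)) ⊗ₜ[k] m = ((b' * b) • n) ⊗ₜ[k] m
    rw [mul_smul]

/-- The evaluation `φ ⊗ m ↦ φ(1 ⊗ m)` as a `k`-linear map. -/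
def evBase (M N : LMod k B) : (tensor (regular k B) M →ₗ[B] N) ⊗[k] M →ₗ[k] N :=
  TensorProduct.lift
    { toFun := fun φ => homVal φ 1
      map_add' := fun _ _ => rfl
      map_smul' := fun _ _ => rfl }

theorem evBase_tmul (M N : LMod k B) (φ : tensor (regular k B) M →ₗ[B] N) (m : M) :
    evBase M N (φ ⊗ₜ m) = homVal φ 1 m := rfl

theorem evBase_smul (M N : LMod k B) (b : B) (t : (tensor (regular k B) M →ₗ[B] N) ⊗[k] M) :
    evBase M N (tensorRep (homRep M N) M.rep b t) = b • evBase M N t := by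
  have h : ∀ (u : B ⊗[k] B) (φ : tensor (regular k B) M →ₗ[B] N) (m : M),
      evBase M N (prodRep (homRep M N) M.rep u (φ ⊗ₜ m)) =
        TensorProduct.lift (homVal φ) (prodRep (Algebra.lsmul k k B) M.rep u ((1 : B) ⊗ₜ[k] m)) := by
    intro u φ m
    induction u with
    | zero => simp
    | add x y hx hy => simp only [map_add, LinearMap.add_apply, hx, hy]
    | tmul a b =>
      change homVal φ (1 * a) (b • m) = homVal φ (a * 1) (b • m)
      rw [one_mul, mul_one]
  induction t with
  | zero => simp
  | add x y hx hy => simp only [map_add, hx, hy, smul_add]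
  | tmul φ m =>
    rw [tensorRep_apply, h, evBase_tmul]
    have h' : ∀ s : B ⊗[k] M, TensorProduct.lift (homVal φ) s = φ s := fun s =>
      LinearMap.congr_fun (TensorProduct.lift_mk_compr₂ (φ.restrictScalars k)) s
    rw [h']
    exact map_smul φ b _

/-- The evaluation `[M, N] ⊗ M ⟶ N`, `φ ⊗ m ↦ φ(1 ⊗ m)`. -/
def ev (M N : LMod k B) : tensor (leftHomObj M N) M ⟶ N :=
  mkHom (M := tensor (leftHomObj M N) M) (evBase M N) (evBase_smul M N)

/-- The left closed structure of `B-Mod`: `[M, -]` is right adjoint to `- ⊗ M`. -/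
def leftHomAdj (M : LMod k B) : tensorRight M ⊣ leftHom M where
  unit :=
    { app := fun N => coev M N
      naturality := fun N N' g => hom_ext fun n => homVal_ext fun b m =>
        congrArg (· ⊗ₜ[k] m) (map_smul g.hom b n).symm }
  counit :=
    { app := fun N => ev M N
      naturality := fun N N' g => Hom.ext (hom_tensor_ext fun φ m => rfl) }
  left_triangle_components N := Hom.ext (hom_tensor_ext fun n m =>
    congrArg (· ⊗ₜ[k] m) (one_smul B n))
  right_triangle_components N := hom_ext fun φ => homVal_ext (N := N) fun b m =>
    congrArg (fun c => homVal (N := N) φ c m) (one_mul b)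

end Closed
end LMod

/-- Given a functor `U : D ⥤ C`, an adjunction `L ⊣ R` on `C` and a lift `L'` of `L` along `U`, a lift
of the adjunction: a right adjoint of `L'` that lifts `R`, such that `U` carries unit and counit to
the unit and counit of `L ⊣ R`. The lifts are understood up to specified isomorphisms
`L' ⋙ U ≅ U ⋙ L` and `R' ⋙ U ≅ U ⋙ R`. -/
structure AdjunctionLift {C : Type w} [Category.{v} C] {D : Type w'} [Category.{v'} D]
    (U : D ⥤ C) {L R : C ⥤ C} (adj : L ⊣ R) {L' : D ⥤ D} (l : L' ⋙ U ≅ U ⋙ L) where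
  rightAdj : D ⥤ D
  adjunction : L' ⊣ rightAdj
  comparison : rightAdj ⋙ U ≅ U ⋙ R
  unit_lift : ∀ N : D, U.map (adjunction.unit.app N) ≫ comparison.hom.app (L'.obj N) ≫
    R.map (l.hom.app N) = adj.unit.app (U.obj N)
  counit_lift : ∀ N : D, U.map (adjunction.counit.app N) =
    l.hom.app (rightAdj.obj N) ≫ L.map (comparison.hom.app N) ≫ adj.counit.app (U.obj N)

section
variable {k B H : Type u} [CommRing k] [Ring B] [Bialgebra k B] [Ring H] [Bialgebra k H]

/-- The bimonad `H ⊗_B -` on `B-Mod` induced by a bialgebra map `f : B → H`. -/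
def extensionBimonad (f : B →ₐc[k] H) : Bimonad (LMod k B) :=
  Bimonad.ofAdjunction (LMod.induceAdj f)

/-- The left closed structure of `B-Mod` lifts along restriction of scalars to `H-Mod`: for every
`H`-module `M` the adjunction `- ⊗ U M ⊣ [U M, -]` lifts to an adjunction with left adjoint `- ⊗ M`. -/
def LiftsLeftClosed (f : B →ₐc[k] H) : Prop :=
  ∀ M : LMod k H, Nonempty (AdjunctionLift (LMod.restrict f)
    (LMod.leftHomAdj ((LMod.restrict f).obj M))
    (Functor.Monoidal.commTensorRight (LMod.restrict f) M).symm)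
end

namespace LMod

section Formulas

variable {k B H : Type u} [CommRing k] [Ring B] [Bialgebra k B] [Ring H] [Bialgebra k H]
  (f : B →ₐc[k] H) (M N : LMod k B)

theorem induceAdj_homEquiv (P : LMod k H) :
    (induceAdj f).homEquiv M P = induceHomEquiv f M P := by
  ext φ
  rw [Adjunction.homEquiv_unit]
  rfl

theorem induceAdj_homEquiv_symm_apply (P : LMod k H) (g : M ⟶ restrictObj f P) (h : H) (m : M) :
    (((induceAdj f).homEquiv M P).symm g).hom (induceMk f M (h ⊗ₜ m)) = h • toBase f g m := by
  rw [induceAdj_homEquiv]; rfl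

/-- `η(m) = 1 ⊗ m`. -/
theorem extensionBimonad_η_apply (m : M) :
    ((extensionBimonad f).η.app M).hom m = induceMk f M (1 ⊗ₜ m) := rfl

/-- `μ(h ⊗ (h' ⊗ m)) = h h' ⊗ m`. -/
theorem extensionBimonad_μ_apply (h h' : H) (m : M) :
    ((extensionBimonad f).μ.app M).hom
      (induceMk f (restrictObj f (induceObj f M)) (h ⊗ₜ induceMk f M (h' ⊗ₜ m))) =
      induceMk f M ((h * h') ⊗ₜ m) := rfl

/-- `T₂(h ⊗ (m ⊗ n)) = (h₍₁₎ ⊗ m) ⊗ (h₍₂₎ ⊗ n)`. -/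
theorem extensionBimonad_oplax_δ_apply (h : H) (m : M) (n : N) :
    ((extensionBimonad f).oplax.δ M N).hom (induceMk f (tensor M N) (h ⊗ₜ (m ⊗ₜ[k] n))) =
      prodRep (induceObj f M).rep (induceObj f N).rep (Coalgebra.comul h)
        (induceMk f M (1 ⊗ₜ m) ⊗ₜ[k] induceMk f N (1 ⊗ₜ n)) :=
  induceAdj_homEquiv_symm_apply f (tensor M N) (tensor (induceObj f M) (induceObj f N)) _ h
    (m ⊗ₜ[k] n)

/-- `T₀(h ⊗ c) = ε(h) c`. -/
theorem extensionBimonad_oplax_η_apply (h : H) (c : k) :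
    ((extensionBimonad f).oplax.η).hom (induceMk f (unit k B) (h ⊗ₜ c)) = (unitRep k H h c : k) :=
  induceAdj_homEquiv_symm_apply f (unit k B) (unit k H) _ h c

end Formulas

end LMod

section
variable {k B : Type u} [CommRing k] [Ring B] [Algebra k B]

/-- The defining relations of `B[x; d]` on the free algebra on the set `B ∪ {x}`: those of the algebra
`B`, and `x b = b x + d(b)`. Here `some b` stands for `b` and `none` for `x`. -/
inductive OreExt.Rel (d : B →ₗ[k] B) : FreeAlgebra k (Option B) → FreeAlgebra k (Option B) → Prop
  | add (a b : B) : Rel d (FreeAlgebra.ι k (some (a + b)))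
      (FreeAlgebra.ι k (some a) + FreeAlgebra.ι k (some b))
  | mul (a b : B) : Rel d (FreeAlgebra.ι k (some (a * b)))
      (FreeAlgebra.ι k (some a) * FreeAlgebra.ι k (some b))
  | scalar (r : k) : Rel d (FreeAlgebra.ι k (some (algebraMap k B r)))
      (algebraMap k (FreeAlgebra k (Option B)) r)
  | comm (b : B) : Rel d (FreeAlgebra.ι k none * FreeAlgebra.ι k (some b))
      (FreeAlgebra.ι k (some b) * FreeAlgebra.ι k none + FreeAlgebra.ι k (some (d b)))

/-- The Ore extension `B[x; d]`. -/
def OreExt (d : B →ₗ[k] B) : Type u := RingQuot (OreExt.Rel d)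

namespace OreExt

instance (d : B →ₗ[k] B) : Ring (OreExt d) := inferInstanceAs (Ring (RingQuot (OreExt.Rel d)))

/-- The `k`-algebra structure of the Ore extension. -/
@[reducible]
def algebra (d : B →ₗ[k] B) : Algebra k (OreExt d) :=
  inferInstanceAs (Algebra k (RingQuot (OreExt.Rel d)))

/-- The natural algebra map `B → B[x; d]`. -/
def of (d : B →ₗ[k] B) (b : B) : OreExt d :=
  RingQuot.mkAlgHom k (Rel d) (FreeAlgebra.ι k (some b))

/-- The element `x` of `B[x; d]`. -/
def X (d : B →ₗ[k] B) : OreExt d :=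
  RingQuot.mkAlgHom k (Rel d) (FreeAlgebra.ι k none)
end OreExt
end

/-!
Two facts carry the proof.

Write `H = B[x; d]`. The closed structure lifts because `x` acts on `[M, N] = Hom_B(B ⊗ M, N)` by a
commutator. The Leibniz rule makes `B` an `H`-module, with `B` acting by left multiplication and `x`
by `d`, so `x` acts on `B ⊗ M`, where it satisfies `x (b t) = b (x t) + d(b) t`. Hence
`φ ↦ x φ - φ x` sends `B`-linear maps to `B`-linear maps, and it satisfies the commutation relation
of `H` with the action of `B` on `[M, N]`. As `x` is primitive and `d(1) = 0`, evaluation and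
coevaluation commute with `x`, and a `B`-linear map that commutes with `x` is `H`-linear
(`IsPrimitiveOre.liftsLeftClosed`).

The Hopf property follows formally. Let `F ⊣ U` with `U` strong monoidal, and let the right adjoints
of all `- ⊗ U P` lift along `U`. Then morphisms out of `F (X ⊗ U P)` and out of `F X ⊗ P` both
correspond to morphisms from `X` to the inner hom of `U P`, so the canonical morphism
`F (X ⊗ U P) ⟶ F X ⊗ P` is invertible by Yoneda (`isIso_projectionHom`), and the left fusion operator
is its image under `U` for `P = F Y`. In particular no basis of `H` over `B` is needed.

The bialgebra structure is obtained from the universal property of `B[x; d]`, and `B` embeds because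
it acts faithfully on the module `B` above.
-/

/-! ### Lifting closed structures forces the Hopf property -/

section FusionOfLift

open Functor.OplaxMonoidal Functor.LaxMonoidal

variable {C : Type w} [Category.{v} C] [MonoidalCategory C]
  {D : Type w'} [Category.{v'} D] [MonoidalCategory D] {F : C ⥤ D} {U : D ⥤ C} (adj : F ⊣ U)
  [U.Monoidal]

/-- The canonical morphism `F (X ⊗ U P) ⟶ F X ⊗ P` of the projection formula: the transpose of
`X ⊗ U P ⟶ U F X ⊗ U P ≅ U (F X ⊗ P)`. -/
def projectionHom (X : C) (P : D) : F.obj (X ⊗ U.obj P) ⟶ F.obj X ⊗ P :=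
  (adj.homEquiv _ _).symm (adj.unit.app X ▷ U.obj P ≫ μ U (F.obj X) P)

/-- For `T = U F`, the left fusion operator is `U` of the projection formula morphism for a free
object `P = F Y`. -/
theorem Bimonad.leftFusion_ofAdjunction (X Y : C) :
    (Bimonad.ofAdjunction adj).leftFusion X Y =
      U.map (projectionHom adj X (F.obj Y)) ≫ δ U (F.obj X) (F.obj Y) := by
  change (oplaxOfAdjunction adj).δ X (U.obj (F.obj Y)) ≫
    (U.obj (F.obj X) ◁ U.map (adj.counit.app (F.obj Y))) = _
  rw [oplaxOfAdjunction_δ, Category.assoc, δ_natural_right, ← Category.assoc, ← U.map_comp]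
  congr 2
  refine (Equiv.eq_symm_apply (adj.homEquiv (X ⊗ U.obj (F.obj Y)) (F.obj X ⊗ F.obj Y))).2 ?_
  have htri : U.obj (F.obj X) ◁ adj.unit.app (U.obj (F.obj Y)) ≫
      U.obj (F.obj X) ◁ U.map (adj.counit.app (F.obj Y)) = 𝟙 _ := by
    rw [← whiskerLeft_comp, Adjunction.right_triangle_components]
    exact whiskerLeft_id _ _
  -- `F (η ⊗ η)`, `F μ` and the counit compose to a transpose, so naturality in the target applies.
  have hsymm := adj.homEquiv_counit (X := X ⊗ U.obj (F.obj Y))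
    (g := (adj.unit.app X ⊗ₘ adj.unit.app (U.obj (F.obj Y))) ≫
      μ U (F.obj X) (F.obj (U.obj (F.obj Y))))
  rw [F.map_comp, Category.assoc] at hsymm
  refine (adj.homEquiv_naturality_right _ _).trans ?_
  refine (congrArg (· ≫ _) ((Equiv.symm_apply_eq _).1 hsymm).symm).trans ?_
  rw [Category.assoc, ← μ_natural_right, MonoidalCategory.tensorHom_def, Category.assoc]
  exact congrArg (adj.unit.app X ▷ U.obj (F.obj Y) ≫ ·) ((reassoc_of% htri) _)

/-- If an adjunction `- ⊗ U P ⊣ R` lifts along `U`, then `Hom(F X ⊗ P, Z)` and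
`Hom(F (X ⊗ U P), Z)` are both `Hom(X, R U Z)`, so the projection formula holds by Yoneda. -/
theorem isIso_projectionHom {P : D} {R : C ⥤ C} {adj' : tensorRight (U.obj P) ⊣ R}
    (lift : AdjunctionLift U adj' (Functor.Monoidal.commTensorRight U P).symm) (X : C) :
    IsIso (projectionHom adj X P) := by
  rw [isIso_iff_coyoneda_map_bijective]
  intro Z
  let e : (F.obj X ⊗ P ⟶ Z) ≃ (F.obj (X ⊗ U.obj P) ⟶ Z) :=
    (lift.adjunction.homEquiv (F.obj X) Z).trans <| (adj.homEquiv X (lift.rightAdj.obj Z)).trans <|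
      (((Iso.refl X).homCongr (lift.comparison.app Z)).trans
        (adj'.homEquiv X (U.obj Z)).symm).trans (adj.homEquiv (X ⊗ U.obj P) Z).symm
  -- Both sides transpose to `η_X`, then the coevaluation of `U F X`, then `R` of `μ ≫ U g`.
  have he : (fun g : F.obj X ⊗ P ⟶ Z => projectionHom adj X P ≫ g) = e := by
    funext g
    apply (adj.homEquiv _ _).injective
    apply (adj'.homEquiv X (U.obj Z)).injective
    have hnat : U.map (lift.rightAdj.map g) ≫ lift.comparison.hom.app Z =
        lift.comparison.hom.app (F.obj X ⊗ P) ≫ R.map (U.map g) := lift.comparison.hom.naturality g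
    have hunit : U.map (lift.adjunction.unit.app (F.obj X)) ≫
        lift.comparison.hom.app (F.obj X ⊗ P) ≫ R.map (δ U (F.obj X) P) =
          adj'.unit.app (U.obj (F.obj X)) := lift.unit_lift (F.obj X)
    have hg : lift.adjunction.homEquiv (F.obj X) Z g =
        lift.adjunction.unit.app (F.obj X) ≫ lift.rightAdj.map g :=
      lift.adjunction.homEquiv_unit _ _ _
    have hη : adj'.unit.app X ≫ R.map (adj.unit.app X ▷ U.obj P) =
        adj.unit.app X ≫ adj'.unit.app (U.obj (F.obj X)) := adj'.unit_naturality (adj.unit.app X)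
    simp only [e, Equiv.trans_apply, Equiv.apply_symm_apply, projectionHom,
      Adjunction.homEquiv_naturality_right, Iso.homCongr_apply, Iso.refl_inv, Category.id_comp,
      Iso.app_hom]
    simp only [hg, Adjunction.homEquiv_unit, Functor.map_comp, Category.assoc]
    rw [hnat, reassoc_of% hη, ← hunit]
    simp only [Category.assoc]
    rw [← R.map_comp_assoc (δ U _ _), Functor.Monoidal.δ_μ, R.map_id, Category.id_comp]
  rw [he]
  exact e.bijective

/-- The bimonad of `F ⊣ U` is left Hopf if all right adjoints of `- ⊗ U P` lift along `U`. -/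
theorem Bimonad.isLeftHopf_ofAdjunction {R : D → C ⥤ C}
    (adj' : ∀ P : D, tensorRight (U.obj P) ⊣ R P)
    (lift : ∀ P : D, Nonempty (AdjunctionLift U (adj' P)
      (Functor.Monoidal.commTensorRight U P).symm)) :
    (Bimonad.ofAdjunction adj).IsLeftHopf := by
  intro X Y
  obtain ⟨lift⟩ := lift (F.obj Y)
  have := isIso_projectionHom adj lift X
  rw [leftFusion_ofAdjunction]
  exact inferInstanceAs
    (IsIso (U.map (projectionHom adj X (F.obj Y)) ≫ δ U (F.obj X) (F.obj Y)))

end FusionOfLift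

/-! ### The Ore extension and its bialgebra structure -/

namespace OreExt

section Algebra

variable {k B : Type u} [CommRing k] [Ring B] [Algebra k B] (d : B →ₗ[k] B)

attribute [local instance] OreExt.algebra

/-- The natural map `B → B[x; d]` as an algebra homomorphism. -/
def ofAlgHom : B →ₐ[k] OreExt d :=
  AlgHom.ofLinearMap
    { toFun := of d
      map_add' := fun a b => by
        have h := RingQuot.mkAlgHom_rel k (Rel.add (d := d) a b)
        rwa [map_add] at h
      map_smul' := fun r b => by
        have h := RingQuot.mkAlgHom_rel k (Rel.mul (d := d) (algebraMap k B r) b)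
        rw [map_mul, RingQuot.mkAlgHom_rel k (Rel.scalar r), AlgHom.commutes] at h
        rw [Algebra.smul_def, Algebra.smul_def]
        exact h }
    (by
      have h := RingQuot.mkAlgHom_rel k (Rel.scalar (d := d) 1)
      rw [map_one, map_one, map_one] at h
      exact h)
    fun a b => by
      have h := RingQuot.mkAlgHom_rel k (Rel.mul (d := d) a b)
      rwa [map_mul] at h

theorem X_mul_of (b : B) :
    X d * ofAlgHom d b = ofAlgHom d b * X d + ofAlgHom d (d b) := by
  have h := RingQuot.mkAlgHom_rel k (Rel.comm (d := d) b)
  rw [map_mul, map_add, map_mul] at h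
  exact h

variable {d} {A : Type*} [Ring A] [Algebra k A]

/-- The universal property of `B[x; d]`: an algebra map `g` on `B` extends along `x ↦ y` as soon as
`y g(b) = g(b) y + g(d(b))`. -/
def lift (g : B →ₐ[k] A) (y : A) (h : ∀ b, y * g b = g b * y + g (d b)) : OreExt d →ₐ[k] A :=
  RingQuot.liftAlgHom k ⟨FreeAlgebra.lift k fun s => s.elim y g, fun a b r => by
    cases r <;> simp [h]⟩

theorem lift_of (g : B →ₐ[k] A) (y : A) (h : ∀ b, y * g b = g b * y + g (d b)) (b : B) :
    lift g y h (ofAlgHom d b) = g b :=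
  (RingQuot.liftAlgHom_mkAlgHom_apply k _ _ _).trans (FreeAlgebra.lift_ι_apply _ _)

theorem lift_X (g : B →ₐ[k] A) (y : A) (h : ∀ b, y * g b = g b * y + g (d b)) :
    lift g y h (X d) = y :=
  (RingQuot.liftAlgHom_mkAlgHom_apply k _ _ _).trans (FreeAlgebra.lift_ι_apply _ _)

variable (d) in
theorem adjoin_eq_top : Algebra.adjoin k (insert (X d) (Set.range (ofAlgHom d))) = ⊤ := by
  have h := congrArg (Subalgebra.map (RingQuot.mkAlgHom k (Rel d)))
    (FreeAlgebra.adjoin_range_ι (R := k) (X := Option B))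
  rw [AlgHom.map_adjoin, Algebra.map_top,
    (AlgHom.range_eq_top _).2 (RingQuot.mkAlgHom_surjective k (Rel d))] at h
  rw [eq_top_iff]
  refine h.ge.trans (Algebra.adjoin_mono ?_)
  rintro _ ⟨_, ⟨s, rfl⟩, rfl⟩
  cases s with
  | none => exact Set.mem_insert _ _
  | some b => exact Set.mem_insert_of_mem _ ⟨b, rfl⟩

theorem algHom_ext {φ ψ : OreExt d →ₐ[k] A} (hB : φ.comp (ofAlgHom d) = ψ.comp (ofAlgHom d))
    (hX : φ (X d) = ψ (X d)) : φ = ψ := by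
  refine AlgHom.ext_of_adjoin_eq_top (adjoin_eq_top d) ?_
  rintro _ (rfl | ⟨b, rfl⟩)
  · exact hX
  · exact DFunLike.congr_fun hB b

/-- `B[x; d]` acts on `B`, with `B` acting by left multiplication and `x` by `d`; evaluation at `1`
recovers `b` from its image. -/
theorem ofAlgHom_injective (hd : ∀ a b : B, d (a * b) = d a * b + a * d b) :
    Function.Injective (ofAlgHom d) := by
  let φ : OreExt d →ₐ[k] Module.End k B := lift (Algebra.lmul k B) d fun b =>
    LinearMap.ext fun c => (hd b c).trans (add_comm _ _)
  intro a b h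
  have h' : φ (ofAlgHom d a) 1 = φ (ofAlgHom d b) 1 := by rw [h]
  simpa [φ, lift_of] using h'

end Algebra

section Bialgebra

variable {k B : Type u} [CommRing k] [Ring B] [Bialgebra k B] {d : B →ₗ[k] B}

attribute [local instance] OreExt.algebra

/-- The comultiplication of `B[x; d]`: that of `B`, with `x` primitive. -/
def comul (hcomul : ∀ b : B, Coalgebra.comul (R := k) (d b) =
      d.rTensor B (Coalgebra.comul (R := k) b) + d.lTensor B (Coalgebra.comul (R := k) b)) :
    OreExt d →ₐ[k] OreExt d ⊗[k] OreExt d :=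
  lift ((Algebra.TensorProduct.map (ofAlgHom d) (ofAlgHom d)).comp (Bialgebra.comulAlgHom k B))
    (X d ⊗ₜ 1 + 1 ⊗ₜ X d) fun b => by
      have key : ∀ u : B ⊗[k] B,
          (X d ⊗ₜ[k] 1 + 1 ⊗ₜ[k] X d) * Algebra.TensorProduct.map (ofAlgHom d) (ofAlgHom d) u =
            Algebra.TensorProduct.map (ofAlgHom d) (ofAlgHom d) u *
                (X d ⊗ₜ[k] 1 + 1 ⊗ₜ[k] X d) +
              Algebra.TensorProduct.map (ofAlgHom d) (ofAlgHom d)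
                (d.rTensor B u + d.lTensor B u) := by
        intro u
        induction u with
        | zero => simp
        | add x y hx hy => simp only [map_add, mul_add, add_mul] at hx hy ⊢; grind
        | tmul a b =>
          simp only [Algebra.TensorProduct.map_tmul, LinearMap.rTensor_tmul,
            LinearMap.lTensor_tmul, map_add, add_mul, mul_add,
            Algebra.TensorProduct.tmul_mul_tmul, one_mul, mul_one, X_mul_of, add_tmul, tmul_add]
          abel
      simpa [hcomul] using key (Coalgebra.comul b)

theorem comul_of (hcomul : ∀ b : B, Coalgebra.comul (R := k) (d b) =
      d.rTensor B (Coalgebra.comul (R := k) b) + d.lTensor B (Coalgebra.comul (R := k) b)) (b : B) :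
    comul hcomul (ofAlgHom d b) =
      Algebra.TensorProduct.map (ofAlgHom d) (ofAlgHom d) (Coalgebra.comul b) :=
  lift_of _ _ _ b

theorem comul_X (hcomul : ∀ b : B, Coalgebra.comul (R := k) (d b) =
      d.rTensor B (Coalgebra.comul (R := k) b) + d.lTensor B (Coalgebra.comul (R := k) b)) :
    comul hcomul (X d) = X d ⊗ₜ 1 + 1 ⊗ₜ X d :=
  lift_X _ _ _

/-- The counit of `B[x; d]`: that of `B`, with `x ↦ 0`. -/
def counit (hcounit : ∀ b : B, Coalgebra.counit (R := k) (d b) = 0) : OreExt d →ₐ[k] k :=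
  lift (Bialgebra.counitAlgHom k B) 0 fun b => by simp [hcounit]

theorem counit_of (hcounit : ∀ b : B, Coalgebra.counit (R := k) (d b) = 0) (b : B) :
    counit hcounit (ofAlgHom d b) = Coalgebra.counit b :=
  lift_of _ _ _ b

theorem counit_X (hcounit : ∀ b : B, Coalgebra.counit (R := k) (d b) = 0) :
    counit hcounit (X d) = 0 :=
  lift_X _ _ _

/-- The bialgebra structure on `B[x; d]` that extends the one of `B` and makes `x` primitive. -/
@[reducible]
def bialgebra (hcomul : ∀ b : B, Coalgebra.comul (R := k) (d b) =
      d.rTensor B (Coalgebra.comul (R := k) b) + d.lTensor B (Coalgebra.comul (R := k) b))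
    (hcounit : ∀ b : B, Coalgebra.counit (R := k) (d b) = 0) : Bialgebra k (OreExt d) :=
  Bialgebra.ofAlgHom (comul hcomul) (counit hcounit)
    (by
      refine algHom_ext (AlgHom.ext fun b => ?_) ?_
      -- On `B` both sides are the image of the iterated coproduct of `B` in `H ⊗ (H ⊗ H)`.
      · have h₁ : ∀ (u : B ⊗[k] B) (b : B), Algebra.TensorProduct.assoc k k k _ _ _
            (Algebra.TensorProduct.map (ofAlgHom d) (ofAlgHom d) u ⊗ₜ ofAlgHom d b) =
            TensorProduct.map (ofAlgHom d).toLinearMap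
              (TensorProduct.map (ofAlgHom d).toLinearMap (ofAlgHom d).toLinearMap)
              (TensorProduct.assoc k B B B (u ⊗ₜ b)) := by
          intro u b
          induction u with
          | zero => simp
          | add x y hx hy => simp only [map_add, add_tmul, hx, hy]
          | tmul a c => rfl
        have h₂ : ∀ u : B ⊗[k] B, Algebra.TensorProduct.assoc k k k _ _ _
            (Algebra.TensorProduct.map (comul hcomul) (.id k _)
              (Algebra.TensorProduct.map (ofAlgHom d) (ofAlgHom d) u)) =
            TensorProduct.map (ofAlgHom d).toLinearMap
              (TensorProduct.map (ofAlgHom d).toLinearMap (ofAlgHom d).toLinearMap)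
              (TensorProduct.assoc k B B B (Coalgebra.comul.rTensor B u)) := by
          intro u
          induction u with
          | zero => simp
          | add x y hx hy => simp only [map_add, hx, hy]
          | tmul a b => simpa [comul_of] using h₁ (Coalgebra.comul a) b
        have h₃ : ∀ u : B ⊗[k] B, Algebra.TensorProduct.map (.id k _) (comul hcomul)
              (Algebra.TensorProduct.map (ofAlgHom d) (ofAlgHom d) u) =
            TensorProduct.map (ofAlgHom d).toLinearMap
              (TensorProduct.map (ofAlgHom d).toLinearMap (ofAlgHom d).toLinearMap)
              (Coalgebra.comul.lTensor B u) := by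
          intro u
          induction u with
          | zero => simp
          | add x y hx hy => simp only [map_add, hx, hy]
          | tmul a b => simp [comul_of]; rfl
        change Algebra.TensorProduct.assoc k k k _ _ _
          (Algebra.TensorProduct.map (comul hcomul) (.id k _) (comul hcomul (ofAlgHom d b))) =
          Algebra.TensorProduct.map (.id k _) (comul hcomul) (comul hcomul (ofAlgHom d b))
        rw [comul_of, h₂, h₃, Coalgebra.coassoc_apply]
      · simp [comul_X, add_tmul, tmul_add, add_assoc, Algebra.TensorProduct.one_def])
    (by
      refine algHom_ext (AlgHom.ext fun b => ?_) ?_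
      · have h : ∀ u : B ⊗[k] B, Algebra.TensorProduct.map (counit hcounit) (.id k _)
            (Algebra.TensorProduct.map (ofAlgHom d) (ofAlgHom d) u) =
            (ofAlgHom d).toLinearMap.lTensor k (Coalgebra.counit.rTensor B u) := by
          intro u
          induction u with
          | zero => simp
          | add x y hx hy => simp only [map_add, hx, hy]
          | tmul a b => simp [counit_of]
        change Algebra.TensorProduct.map (counit hcounit) (.id k _)
          (comul hcomul (ofAlgHom d b)) = _
        rw [comul_of, h, Coalgebra.rTensor_counit_comul]
        rfl
      · simp [comul_X, counit_X])
    (by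
      refine algHom_ext (AlgHom.ext fun b => ?_) ?_
      · have h : ∀ u : B ⊗[k] B, Algebra.TensorProduct.map (.id k _) (counit hcounit)
            (Algebra.TensorProduct.map (ofAlgHom d) (ofAlgHom d) u) =
            (ofAlgHom d).toLinearMap.rTensor k (Coalgebra.counit.lTensor B u) := by
          intro u
          induction u with
          | zero => simp
          | add x y hx hy => simp only [map_add, hx, hy]
          | tmul a b => simp [counit_of]
        change Algebra.TensorProduct.map (.id k _) (counit hcounit)
          (comul hcomul (ofAlgHom d b)) = _
        rw [comul_of, h, Coalgebra.lTensor_counit_comul]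
        rfl
      · simp [comul_X, counit_X])

/-- The natural map `B → B[x; d]` as a bialgebra homomorphism. -/
def ofBialgHom (hcomul : ∀ b : B, Coalgebra.comul (R := k) (d b) =
      d.rTensor B (Coalgebra.comul (R := k) b) + d.lTensor B (Coalgebra.comul (R := k) b))
    (hcounit : ∀ b : B, Coalgebra.counit (R := k) (d b) = 0) :
    letI := bialgebra hcomul hcounit
    B →ₐc[k] OreExt d :=
  letI := bialgebra hcomul hcounit
  BialgHom.ofAlgHom (ofAlgHom d) (AlgHom.ext (counit_of hcounit))
    (AlgHom.ext fun b => (comul_of hcomul b).symm)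

end Bialgebra
end OreExt

/-! ### Lifting the closed structure along an Ore extension -/

noncomputable section

/-- A bialgebra map `f : B → H` exhibits `H` as the Ore extension `B[x; d]` with `x` primitive:
`d` is a derivation, `H` is generated by `f(B)` and `x`, the commutation relation holds, and every
`B`-module with a compatible endomorphism is an `H`-module. The last condition is the universal
property of `B[x; d]`, restricted to the targets `End_k(V)`. -/
structure IsPrimitiveOre {k B H : Type u} [CommRing k] [Ring B] [Bialgebra k B] [Ring H]
    [Bialgebra k H] (f : B →ₐc[k] H) (x : H) (d : B →ₗ[k] B) : Prop where
  leibniz : ∀ a b : B, d (a * b) = d a * b + a * d b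
  x_mul : ∀ b : B, x * f b = f b * x + f (d b)
  comul_x : Coalgebra.comul (R := k) x = x ⊗ₜ[k] 1 + 1 ⊗ₜ[k] x
  adjoin_eq_top : Algebra.adjoin k (insert x (Set.range f)) = ⊤
  exists_lift : ∀ {V : Type u} [AddCommGroup V] [Module k V] (ρ : B →ₐ[k] Module.End k V)
    (y : Module.End k V), (∀ b, y * ρ b = ρ b * y + ρ (d b)) →
    ∃ σ : H →ₐ[k] Module.End k V, (∀ b, σ (f b) = ρ b) ∧ σ x = y

namespace IsPrimitiveOre

variable {k B H : Type u} [CommRing k] [Ring B] [Bialgebra k B] [Ring H] [Bialgebra k H]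
  {f : B →ₐc[k] H} {x : H} {d : B →ₗ[k] B} (hf : IsPrimitiveOre f x d)

section Lift

variable {V : Type u} [AddCommGroup V] [Module k V] (ρ : B →ₐ[k] Module.End k V)
  (y : Module.End k V) (h : ∀ b, y * ρ b = ρ b * y + ρ (d b))

/-- The action of `H` on a `B`-module with a compatible endomorphism `y`, where `x` acts by `y`.
(It is unique, as `f(B)` and `x` generate `H`, so the choice is harmless.) -/
def lift : H →ₐ[k] Module.End k V := (hf.exists_lift ρ y h).choose

theorem lift_map (b : B) : hf.lift ρ y h (f b) = ρ b := (hf.exists_lift ρ y h).choose_spec.1 b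

theorem lift_x : hf.lift ρ y h x = y := (hf.exists_lift ρ y h).choose_spec.2

end Lift

/-- A morphism of `B`-modules that commutes with `x` is a morphism of `H`-modules. -/
theorem map_smul_of_generators (hf : IsPrimitiveOre f x d) {M N : LMod k H} (φ : M →ₗ[k] N)
    (hB : ∀ (b : B) (m : M), φ (f b • m) = f b • φ m) (hx : ∀ m : M, φ (x • m) = x • φ m)
    (h : H) (m : M) : φ (h • m) = h • φ m := by
  have hh : h ∈ Algebra.adjoin k (insert x (Set.range f)) := hf.adjoin_eq_top ▸ Algebra.mem_top
  induction hh using Algebra.adjoin_induction generalizing m with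
  | mem a ha =>
    rcases ha with rfl | ⟨b, rfl⟩
    · exact hx m
    · exact hB b m
  | algebraMap r => simp [algebraMap_smul]
  | add a b _ _ ha hb => simp only [add_smul, map_add, ha, hb]
  | mul a b _ _ ha hb => simp only [mul_smul, ha, hb]

theorem tensorRep_x_tmul (hf : IsPrimitiveOre f x d) {V W : Type u} [AddCommGroup V] [Module k V]
    [AddCommGroup W] [Module k W] (ρ : H →ₐ[k] Module.End k V) (σ : H →ₐ[k] Module.End k W)
    (v : V) (w : W) :
    tensorRep ρ σ x (v ⊗ₜ w) = ρ x v ⊗ₜ w + v ⊗ₜ σ x w := by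
  rw [tensorRep_apply, hf.comul_x]
  simp

theorem d_one (hf : IsPrimitiveOre f x d) : d 1 = 0 := by
  simpa using hf.leibniz 1 1

/-- `B` as an `H`-module: `B` acts by left multiplication and `x` by `d`. -/
def regularRep : H →ₐ[k] Module.End k B :=
  hf.lift (Algebra.lmul k B) d fun b =>
    LinearMap.ext fun c => (hf.leibniz b c).trans (add_comm _ _)

section InnerHom

open LMod

variable (M N : LMod k H)

/-- The action of `x` on the `H`-module `B ⊗ M`: `b ⊗ m ↦ d(b) ⊗ m + b ⊗ x m`. -/
def tensorX : B ⊗[k] M →ₗ[k] B ⊗[k] M := tensorRep hf.regularRep M.rep x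

theorem tensorX_tmul (b : B) (m : M) :
    hf.tensorX M (b ⊗ₜ m) = d b ⊗ₜ m + b ⊗ₜ (x • m) := by
  rw [tensorX, hf.tensorRep_x_tmul, regularRep, lift_x]
  rfl

/-- `x (b t) = b (x t) + d(b) t` on `B ⊗ M`. -/
theorem tensorX_rep (b : B) (t : B ⊗[k] M) :
    hf.tensorX M (tensorRep (Algebra.lmul k B) (M.rep.comp (f : B →ₐ[k] H)) b t) =
      tensorRep (Algebra.lmul k B) (M.rep.comp (f : B →ₐ[k] H)) b (hf.tensorX M t) +
        tensorRep (Algebra.lmul k B) (M.rep.comp (f : B →ₐ[k] H)) (d b) t := by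
  have hreg : hf.regularRep.comp (f : B →ₐ[k] H) = Algebra.lmul k B :=
    AlgHom.ext fun b => hf.lift_map _ _ _ b
  rw [← hreg, tensorRep_comp, tensorRep_comp, tensorRep_comp, tensorX, ← Module.End.mul_apply,
    ← map_mul, hf.x_mul, map_add, map_mul]
  rfl

/-- A `B`-linear map `φ : B ⊗ M → N` as a `k`-linear map between the underlying `k`-modules of
`H`-modules, on whose values `x` can act. -/
def homBase (φ : tensor (regular k B) (restrictObj f M) →ₗ[B] restrictObj f N) :
    B ⊗[k] M →ₗ[k] N := φ.restrictScalars k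

/-- `B`-linearity of `φ`, with the action of `B` on `B ⊗ M` and on `N` spelled out. -/
theorem homBase_rep (φ : tensor (regular k B) (restrictObj f M) →ₗ[B] restrictObj f N) (b : B)
    (t : B ⊗[k] M) :
    homBase M N φ (tensorRep (Algebra.lmul k B) (M.rep.comp (f : B →ₐ[k] H)) b t) =
      f b • homBase M N φ t :=
  LinearMap.map_smul φ b (show tensor (regular k B) (restrictObj f M) from t)

theorem homBase_ext {M N : LMod k H}
    {φ ψ : tensor (regular k B) (restrictObj f M) →ₗ[B] restrictObj f N}
    (h : ∀ (b : B) (m : M), homBase M N φ (b ⊗ₜ m) = homBase M N ψ (b ⊗ₜ m)) : φ = ψ :=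
  homVal_ext h

/-- The commutator `x φ - φ x` of a `k`-linear map `φ : B ⊗ M → N` with the action of `x`. -/
def homXBase (φ : B ⊗[k] M →ₗ[k] N) : B ⊗[k] M →ₗ[k] N :=
  N.rep x ∘ₗ φ - φ ∘ₗ hf.tensorX M

theorem homXBase_tmul (φ : B ⊗[k] M →ₗ[k] N) (b : B) (m : M) :
    hf.homXBase M N φ (b ⊗ₜ m) = x • φ (b ⊗ₜ m) - φ (d b ⊗ₜ m) - φ (b ⊗ₜ (x • m)) := by
  change x • φ (b ⊗ₜ m) - φ (hf.tensorX M (b ⊗ₜ m)) = _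
  rw [tensorX_tmul, map_add, sub_add_eq_sub_sub]

/-- The commutator of `x` with a `B`-linear map is `B`-linear: the two terms `d(b) φ(t)` cancel. -/
theorem homXBase_homBase_rep (φ : tensor (regular k B) (restrictObj f M) →ₗ[B] restrictObj f N)
    (b : B) (t : B ⊗[k] M) :
    hf.homXBase M N (homBase M N φ)
        (tensorRep (Algebra.lmul k B) (M.rep.comp (f : B →ₐ[k] H)) b t) =
      f b • hf.homXBase M N (homBase M N φ) t := by
  change x • homBase M N φ _ - homBase M N φ (hf.tensorX M _) =
    f b • (x • homBase M N φ t - homBase M N φ (hf.tensorX M t))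
  rw [tensorX_rep, map_add, homBase_rep, homBase_rep, homBase_rep, smul_smul, hf.x_mul, add_smul,
    smul_sub, mul_smul]
  abel

/-- The action of `x` on `[M, N] = Hom_B(B ⊗ M, N)`: the commutator `φ ↦ x φ - φ x`. -/
def homX : Module.End k (tensor (regular k B) (restrictObj f M) →ₗ[B] restrictObj f N) where
  toFun φ :=
    { toFun := hf.homXBase M N (homBase M N φ)
      map_add' := map_add (hf.homXBase M N (homBase M N φ))
      map_smul' := hf.homXBase_homBase_rep M N φ }
  map_add' φ ψ := LinearMap.ext fun t => by
    change x • (homBase M N φ t + homBase M N ψ t) -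
        (homBase M N φ (hf.tensorX M t) + homBase M N ψ (hf.tensorX M t)) =
      (x • homBase M N φ t - homBase M N φ (hf.tensorX M t)) +
        (x • homBase M N ψ t - homBase M N ψ (hf.tensorX M t))
    rw [smul_add, add_sub_add_comm]
  map_smul' r φ := LinearMap.ext fun t => by
    change x • (r • homBase M N φ t) - r • homBase M N φ (hf.tensorX M t) =
      r • (x • homBase M N φ t - homBase M N φ (hf.tensorX M t))
    rw [smul_sub, smul_comm]

theorem homBase_homX_tmul (φ : tensor (regular k B) (restrictObj f M) →ₗ[B] restrictObj f N)
    (b : B) (m : M) : homBase M N (hf.homX M N φ) (b ⊗ₜ m) =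
      x • homBase M N φ (b ⊗ₜ m) - homBase M N φ (d b ⊗ₜ m) - homBase M N φ (b ⊗ₜ (x • m)) :=
  hf.homXBase_tmul M N _ b m

/-- The representation of `H` on `[M, N]`, which extends that of `B`. -/
def homLift : H →ₐ[k] Module.End k (tensor (regular k B) (restrictObj f M) →ₗ[B] restrictObj f N) :=
  hf.lift (homRep (restrictObj f M) (restrictObj f N)) (hf.homX M N) fun b =>
    LinearMap.ext fun φ => homBase_ext fun b' m => by
      change homBase M N (hf.homX M N (homAct _ _ b φ)) (b' ⊗ₜ m) =
        homBase M N (hf.homX M N φ) ((b' * b) ⊗ₜ m) + homBase M N φ ((b' * d b) ⊗ₜ m)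
      rw [homBase_homX_tmul, homBase_homX_tmul]
      change x • homBase M N φ ((b' * b) ⊗ₜ m) - homBase M N φ ((d b' * b) ⊗ₜ m) -
        homBase M N φ ((b' * b) ⊗ₜ (x • m)) = _
      rw [hf.leibniz, add_tmul, map_add]
      abel

theorem homLift_map (b : B) (φ : tensor (regular k B) (restrictObj f M) →ₗ[B] restrictObj f N) :
    hf.homLift M N (f b) φ = homAct (restrictObj f M) (restrictObj f N) b φ :=
  LinearMap.congr_fun (hf.lift_map _ _ _ b) φ

theorem homLift_x (φ : tensor (regular k B) (restrictObj f M) →ₗ[B] restrictObj f N) :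
    hf.homLift M N x φ = hf.homX M N φ :=
  LinearMap.congr_fun (hf.lift_x _ _ _) φ

/-- The `H`-module structure on the inner hom `[M, N]` of `B`-modules. -/
def innerHomObj : LMod k H :=
  LMod.ofAlgHom (tensor (regular k B) (restrictObj f M) →ₗ[B] restrictObj f N) (hf.homLift M N)

variable {M N}

/-- A morphism of `B`-modules that commutes with `x`, as a morphism of `H`-modules. -/
def mkHom {P Q : LMod k H} (φ : P →ₗ[k] Q) (hB : ∀ (b : B) (p : P), φ (f b • p) = f b • φ p)
    (hx : ∀ p : P, φ (x • p) = x • φ p) : P ⟶ Q :=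
  LMod.mkHom φ (hf.map_smul_of_generators φ hB hx)

/-- Composition with a morphism `g` of `H`-modules, `φ ↦ g φ`. -/
def postComp (M : LMod k H) {N N' : LMod k H} (g : N ⟶ N') :
    (tensor (regular k B) (restrictObj f M) →ₗ[B] restrictObj f N) →ₗ[k]
      (tensor (regular k B) (restrictObj f M) →ₗ[B] restrictObj f N') :=
  base ((leftHom (restrictObj f M)).map ((restrict f).map g))

theorem postComp_homAct {N' : LMod k H} (g : N ⟶ N') (b : B)
    (φ : tensor (regular k B) (restrictObj f M) →ₗ[B] restrictObj f N) :
    postComp M g (homAct _ _ b φ) = homAct _ _ b (postComp M g φ) := rfl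

theorem homBase_postComp {N' : LMod k H} (g : N ⟶ N')
    (φ : tensor (regular k B) (restrictObj f M) →ₗ[B] restrictObj f N) (t : B ⊗[k] M) :
    homBase M N' (postComp M g φ) t = g.hom (homBase M N φ t) := rfl

variable (M)

/-- The functor `[M, -]` on `H`-modules, which lifts `[U M, -]`. -/
def innerHom : LMod k H ⥤ LMod k H where
  obj N := hf.innerHomObj M N
  map {N N'} g :=
    hf.mkHom (P := hf.innerHomObj M N) (Q := hf.innerHomObj M N') (postComp M g)
      (fun b (φ : tensor (regular k B) (restrictObj f M) →ₗ[B] restrictObj f N) => by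
        change postComp M g (hf.homLift M N (f b) φ) = hf.homLift M N' (f b) (postComp M g φ)
        rw [homLift_map, homLift_map, postComp_homAct])
      fun (φ : tensor (regular k B) (restrictObj f M) →ₗ[B] restrictObj f N) => by
        change postComp M g (hf.homLift M N x φ) = hf.homLift M N' x (postComp M g φ)
        rw [homLift_x, homLift_x]
        refine homBase_ext fun b m => ?_
        simp only [homBase_homX_tmul, homBase_postComp, map_sub, map_smul]

/-- The coevaluation `N → [M, N ⊗ M]` as a `k`-linear map. -/
def coevBase (f : B →ₐc[k] H) (M N : LMod k H) :
    N →ₗ[k] (tensor (regular k B) (restrictObj f M) →ₗ[B] restrictObj f (tensor N M)) :=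
  base (coev (restrictObj f M) (restrictObj f N) ≫ (leftHom (restrictObj f M)).map
    (Functor.LaxMonoidal.μ (restrict f) N M))

theorem homBase_coevBase_tmul (N : LMod k H) (n : N) (b : B) (m : M) :
    homBase M (tensor N M) (coevBase f M N n) (b ⊗ₜ m) = (f b • n) ⊗ₜ[k] m := rfl

/-- The coevaluation `N ⟶ [M, N ⊗ M]` of `H`-modules. -/
def innerCoev (N : LMod k H) : N ⟶ hf.innerHomObj M (tensor N M) :=
  hf.mkHom (Q := hf.innerHomObj M (tensor N M)) (coevBase f M N)
    (fun b n => by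
      change coevBase f M N (f b • n) = hf.homLift M (tensor N M) (f b) (coevBase f M N n)
      rw [homLift_map]
      refine homBase_ext fun b' m => ?_
      change (f b' • f b • n) ⊗ₜ[k] m = (f (b' * b) • n) ⊗ₜ[k] m
      rw [map_mul, mul_smul])
    fun n => by
      change coevBase f M N (x • n) = hf.homLift M (tensor N M) x (coevBase f M N n)
      rw [homLift_x]
      refine homBase_ext fun b m => ?_
      rw [homBase_homX_tmul]
      simp only [homBase_coevBase_tmul]
      change _ = tensorRep N.rep M.rep x ((f b • n) ⊗ₜ[k] m) - _ - _
      rw [hf.tensorRep_x_tmul, rep_apply, rep_apply, smul_smul, smul_smul, hf.x_mul, add_smul,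
        add_tmul]
      abel

/-- The evaluation `[M, N] ⊗ M → N` as a `k`-linear map. -/
def innerEvBase (f : B →ₐc[k] H) (M N : LMod k H) :
    (tensor (regular k B) (restrictObj f M) →ₗ[B] restrictObj f N) ⊗[k] M →ₗ[k] N :=
  evBase (restrictObj f M) (restrictObj f N)

theorem innerEvBase_tmul (N : LMod k H)
    (φ : tensor (regular k B) (restrictObj f M) →ₗ[B] restrictObj f N) (m : M) :
    innerEvBase f M N (φ ⊗ₜ m) = homBase M N φ (1 ⊗ₜ m) := rfl

/-- The evaluation `[M, N] ⊗ M ⟶ N` of `H`-modules. -/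
def innerEv (N : LMod k H) : tensor (hf.innerHomObj M N) M ⟶ N :=
  hf.mkHom (P := tensor (hf.innerHomObj M N) M) (innerEvBase f M N)
    (fun b (t : (tensor (regular k B) (restrictObj f M) →ₗ[B] restrictObj f N) ⊗[k] M) => by
      have h := evBase_smul (restrictObj f M) (restrictObj f N) b t
      change evBase (restrictObj f M) (restrictObj f N)
        (tensorRep (hf.homLift M N) M.rep (f b) t) = _
      rw [← tensorRep_comp]
      have h' : (hf.homLift M N).comp (f : B →ₐ[k] H) =
          homRep (restrictObj f M) (restrictObj f N) :=
        AlgHom.ext fun b => hf.lift_map _ _ _ b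
      rw [h']
      exact h)
    fun (t : (tensor (regular k B) (restrictObj f M) →ₗ[B] restrictObj f N) ⊗[k] M) => by
      change innerEvBase f M N (tensorRep (hf.homLift M N) M.rep x t) = x • innerEvBase f M N t
      induction t with
      | zero => simp
      | add s t hs ht => simp only [map_add, smul_add, hs, ht]
      | tmul φ m =>
        rw [hf.tensorRep_x_tmul, map_add, homLift_x, innerEvBase_tmul, innerEvBase_tmul,
          innerEvBase_tmul, homBase_homX_tmul, hf.d_one, zero_tmul, map_zero, rep_apply]
        abel

/-- `- ⊗ M ⊣ [M, -]` on `H`-modules. -/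
def innerHomAdj : tensorRight M ⊣ hf.innerHom M where
  unit :=
    { app := fun N => hf.innerCoev M N
      naturality := fun _ N' g => hom_ext fun n => homBase_ext fun b m =>
        congrArg (· ⊗ₜ[k] m) (map_smul g.hom (f b) n).symm }
  counit :=
    { app := fun N => hf.innerEv M N
      naturality := fun _ _ _ => Hom.ext (hom_tensor_ext fun _ _ => rfl) }
  left_triangle_components N := Hom.ext (hom_tensor_ext fun n m =>
    congrArg (· ⊗ₜ[k] m) ((congrArg (· • n) (map_one f)).trans (one_smul H n)))
  right_triangle_components N := hom_ext
    fun (φ : tensor (regular k B) (restrictObj f M) →ₗ[B] restrictObj f N) => homBase_ext fun b m => by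
      change homBase M N (hf.homLift M N (f b) φ) (1 ⊗ₜ m) = homBase M N φ (b ⊗ₜ m)
      rw [homLift_map]
      exact congrArg (fun c => homBase M N φ (c ⊗ₜ m)) (one_mul b)

/-- `U [M, N] ≅ [U M, U N]`, the identity on elements. -/
def innerHomComparison : hf.innerHom M ⋙ restrict f ≅ restrict f ⋙ leftHom (restrictObj f M) :=
  NatIso.ofComponents
    (fun N => mkIso (M := restrictObj f (hf.innerHomObj M N))
      (N := leftHomObj (restrictObj f M) (restrictObj f N)) (LinearEquiv.refl k _)
      (hf.homLift_map M N))
    fun _ => rfl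

end InnerHom

/-- The closed structure of `B`-modules lifts: unit, counit and comparison are the ones of
`B`-modules on elements. -/
theorem liftsLeftClosed (hf : IsPrimitiveOre f x d) : LiftsLeftClosed f := fun M => ⟨
  { rightAdj := hf.innerHom M
    adjunction := hf.innerHomAdj M
    comparison := hf.innerHomComparison M
    unit_lift := fun _ => rfl
    -- The two sources carry the same `k`-module but different terms for the `B`-action, so the
    -- equation is checked on `k`-linear maps.
    counit_lift := fun _ => LMod.forgetBase.map_injective <|
      ModuleCat.hom_ext <| TensorProduct.ext' fun _ _ => rfl }⟩

end IsPrimitiveOre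

end

/-! ### The bimonad of an Ore extension -/

theorem mainTheorem6 {k B : Type u} [Field k] [Ring B] [Bialgebra k B] (d : B →ₗ[k] B)
    (hd : ∀ a b : B, d (a * b) = d a * b + a * d b)
    (hcomul : ∀ b : B, Coalgebra.comul (R := k) (d b) =
      d.rTensor B (Coalgebra.comul (R := k) b) + d.lTensor B (Coalgebra.comul (R := k) b))
    (hcounit : ∀ b : B, Coalgebra.counit (R := k) (d b) = 0) :
    ∃ S : Bialgebra k (OreExt d), S.toAlgebra = OreExt.algebra d ∧
      Coalgebra.comul (R := k) (OreExt.X d) = OreExt.X d ⊗ₜ[k] 1 + 1 ⊗ₜ[k] OreExt.X d ∧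
      Coalgebra.counit (R := k) (OreExt.X d) = 0 ∧
      ∃ f : B →ₐc[k] OreExt d, (∀ b : B, f b = OreExt.of d b) ∧ Function.Injective f ∧
        (extensionBimonad f).IsLeftHopf ∧ LiftsLeftClosed f := by
  let := OreExt.bialgebra hcomul hcounit
  have hf : IsPrimitiveOre (OreExt.ofBialgHom hcomul hcounit) (OreExt.X d) d :=
    { leibniz := hd
      x_mul := OreExt.X_mul_of d
      comul_x := OreExt.comul_X hcomul
      adjoin_eq_top := OreExt.adjoin_eq_top d
      exists_lift := fun ρ y h => ⟨OreExt.lift ρ y h, OreExt.lift_of ρ y h, OreExt.lift_X ρ y h⟩ }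
  exact ⟨OreExt.bialgebra hcomul hcounit, rfl, OreExt.comul_X hcomul, OreExt.counit_X hcounit,
    OreExt.ofBialgHom hcomul hcounit, fun _ => rfl, OreExt.ofAlgHom_injective hd,
    Bimonad.isLeftHopf_ofAdjunction _ _ hf.liftsLeftClosed, hf.liftsLeftClosed⟩
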